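/- Let $n\ge 1$, $\alpha>0$, $\beta>0$ and $h_1,\dots,h_{n-1}>0$; write $r_0=\alpha$, $r_n=\beta$ and $r_k=h_k$ for $1\le k\le n-1$. Consider the TASEP random dynamical system on the state space $X=\{0,1\}^n$, defined as follows. *Hops.* For $x=(s_1,\dots,s_n)\in X$ and $k\in\{0,\dots,n\}$, $f(x,k)$ is obtained from $x$ by setting $s_1=1$ if $k=0$; by setting $s_n=0$ if $k=n$; by setting $s_k=0$, $s_{k+1}=1$ if $1\le k\le n-1$, $s_k=1$ and $s_{k+1}=0$; and $f(x,k)=x$ otherwise. *Probability space.* A clock is a sequence $(\xi_i)_{i\in\mathbb Z}$ of reals with $\xi_0\ge 0$, $\xi_i>0$ for $i\ne0$ and $\sum_{i\ge0}\xi_i=\sum_{i\ge1}\xi_{-i}=\infty$; it rings at the times $Y_l=\sum_{i=0}^{l}\xi_i$ for $l\ge0$ and $Y_l=-\sum_{i=1}^{-l}\xi_{-i}$ for $l<0$. A clock of rate $r$ is random, with the $\xi_i$ independent and exponentially distributed with rate $r$. $\Omega$ is the set of all $\omega=(\omega_0,\dots,\omega_n)$ consisting of $n+1$ clocks, no two of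 which ever ring at the same time, and $\mathbb P$ is the product measure, restricted to $\Omega$, under which the clocks $\omega_k$ are independent with rates $r_k$. Let $T_{k,j}(\omega)$ be the $j$-th ring time of $\omega_k$. The shift $\theta_s:\Omega\to\Omega$, $s\in\mathbb R$, translates the set of ring times of each clock by $-s$. *Cocycle.* For $\omega\in\Omega$ let $(t_i)_{i\in\mathbb Z}$ be the increasing enumeration of all ring times of all clocks with $t_{-1}<0\le t_0$, and let $k_i$ be the clock that rings at time $t_i$. For $t\ge0$ and $x\in X$, $\varphi(t,x,\omega)$ is the state obtained from $x$ by applying successively, in the order of increasing $i$, the maps $f(\cdot,k_i)$ for all $i$ with $t_i\in[0,t)$. For $t\ge 0$ and $t_0\in\mathbb R$ let $$\Gamma(t,t_0)=\{\omega\in\Omega \mid \varphi(t,x_1,\theta_{t_0}\omega)=\varphi(t,x_2,\theta_{t_0}\omega)\ \text{for all } x_1,x_2\in X\}.$$ Then for every $t>0$ the set $\Gamma(t,0)$ is measurable and there exists $\delta>0$ such that $\mathbb P(\Gamma(t,0))\ge\delta$. -/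

import Mathlib

open MeasureTheory ProbabilityTheory Filter Set

noncomputable section

namespace TASEP

/-! ### Hopping -/

/-- The state space `{0,1}^n` of a chain with `n` sites. Site `k ∈ {1, …, n}` of the chain has
index `k - 1` in `Fin n`; the value `true` means that the site is occupied. -/
abbrev State (n : ℕ) : Type := Fin n → Bool

/-- A single hop `f(x, k)`, for the clock `k ∈ {0, …, n}`: for `k = 0` a particle enters at
site `1`, for `k = n` a particle leaves from site `n`, and otherwise a particle at site `k` (index
`k - 1`) moves to site `k + 1` (index `k`) if the former is occupied and the latter is empty. -/
def hop {n : ℕ} [NeZero n] (x : State n) (k : Fin (n + 1)) : State n :=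
  if h0 : (k : ℕ) = 0 then
    Function.update x ⟨0, NeZero.pos n⟩ true
  else if hn : (k : ℕ) = n then
    Function.update x ⟨n - 1, by have := NeZero.pos n; omega⟩ false
  else
    let a : Fin n := ⟨k - 1, by have := k.isLt; omega⟩
    let b : Fin n := ⟨k, by have := k.isLt; omega⟩
    if x a = true ∧ x b = false then Function.update (Function.update x a false) b true else x

/-- The states `x_0, x_1, x_2, …` given by `x_{p+1} = f(x_p, k_{p + i₀})`. -/
def iterHop {n : ℕ} [NeZero n] (x : State n) (ks : ℤ → Fin (n + 1)) (i₀ : ℤ) : ℕ → State n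
  | 0 => x
  | p + 1 => hop (iterHop x ks i₀ p) (ks (p + i₀))

open Classical in
/-- The state at time `t` when the chain starts in `x` at time `0` and the attempted jumps happen
at the times `ts i` from the sites `ks i`. -/
def tildePhi {n : ℕ} [NeZero n] (t : ℝ) (x : State n) (ts : ℤ → ℝ) (ks : ℤ → Fin (n + 1)) :
    State n :=
  if ∀ i, ts i ∉ Ico 0 t then x
  else
    let i₀ : ℤ := sInf {i | 0 ≤ ts i}
    let i₁ : ℤ := sSup {i | ts i < t}
    iterHop x ks i₀ (i₁ - i₀ + 1).toNat

/-! ### A clock: a two-sided homogeneous Poisson process -/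

/-- The sequences `(ξ_i)_{i ∈ ℤ}` with `ξ_0 ≥ 0`, `ξ_i > 0` for `i ≠ 0`, and
`∑_{i ≥ 0} ξ_i = ∞ = ∑_{i ≥ 1} ξ_{-i}`. -/
def IsClockSeq (ξ : ℤ → ℝ) : Prop :=
  0 ≤ ξ 0 ∧ (∀ i, i ≠ 0 → 0 < ξ i) ∧
    Tendsto (fun N : ℕ => ∑ i ∈ Finset.range N, ξ i) atTop atTop ∧
    Tendsto (fun N : ℕ => ∑ i ∈ Finset.range N, ξ (-(i + 1 : ℤ))) atTop atTop

/-- The sample space of a single clock, with the σ-algebra inherited from the product. -/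
abbrev ClockSpace : Type := {ξ : ℤ → ℝ // IsClockSeq ξ}

/-- The law of a single clock with rate `r`: the `ξ_i` are independent and exponentially
distributed with rate `r`. -/
def clockMeasure (r : ℝ) : Measure ClockSpace :=
  (Measure.infinitePi fun _ : ℤ => expMeasure r).comap Subtype.val

/-- The map `Φ`, giving the times `Y_l` at which the clock rings: `Y_l = ξ_0 + ⋯ + ξ_l` for
`l ≥ 0` and `Y_l = -(ξ_{-1} + ⋯ + ξ_l)` for `l < 0`. -/
def ringTime (ξ : ℤ → ℝ) : ℤ → ℝ
  | Int.ofNat l => ∑ i ∈ Finset.range (l + 1), ξ i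
  | Int.negSucc l => -∑ i ∈ Finset.range (l + 1), ξ (-(i + 1 : ℤ))

/-- The range of `Φ`: the strictly increasing sequences, unbounded above and below, with
`a_{-1} < 0 ≤ a_0`. -/
structure IsRingSeq (a : ℤ → ℝ) : Prop where
  strictMono : StrictMono a
  neg : a (-1) < 0
  nonneg : 0 ≤ a 0
  tendsto_atTop : Tendsto a atTop atTop
  tendsto_atBot : Tendsto a atBot atBot

/-- The inverse `Φ⁻¹`, recovering the `ξ_i` from the ring times. -/
def gaps (a : ℤ → ℝ) (i : ℤ) : ℝ :=
  if i = 0 then a 0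
  else if 0 < i then a i - a (i - 1)
  else if i = -1 then -a (-1)
  else a (i + 1) - a i

theorem ringTime_ofNat (ξ : ℤ → ℝ) (l : ℕ) :
    ringTime ξ (l : ℤ) = ∑ i ∈ Finset.range (l + 1), ξ i := rfl

theorem ringTime_negSucc (ξ : ℤ → ℝ) (l : ℕ) :
    ringTime ξ (-(l + 1 : ℤ)) = -∑ i ∈ Finset.range (l + 1), ξ (-(i + 1 : ℤ)) := by
  rw [show (-(l + 1 : ℤ)) = Int.negSucc l by omega]; rfl

theorem ringTime_gaps (a : ℤ → ℝ) : ringTime (gaps a) = a := by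
  have hpos : ∀ l : ℕ, ringTime (gaps a) (l : ℤ) = a l := by
    intro l
    induction l with
    | zero => rw [ringTime_ofNat]; simp [gaps]
    | succ l ih =>
      rw [ringTime_ofNat] at ih ⊢
      rw [Finset.sum_range_succ, ih, gaps, if_neg (by omega), if_pos (by omega)]
      push_cast
      rw [add_sub_cancel_right]; ring
  have hneg : ∀ l : ℕ, ringTime (gaps a) (-(l + 1 : ℤ)) = a (-(l + 1 : ℤ)) := by
    intro l
    induction l with
    | zero => rw [ringTime_negSucc]; simp [gaps]
    | succ l ih =>
      rw [ringTime_negSucc] at ih ⊢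
      rw [Finset.sum_range_succ, neg_add, ih, gaps, if_neg (by omega), if_neg (by omega),
        if_neg (by omega)]
      push_cast
      rw [show (-(l + 1 + 1 : ℤ) + 1) = -(l + 1 : ℤ) by ring]; ring
  funext l
  rcases lt_or_ge l 0 with h | h
  · obtain ⟨m, rfl⟩ : ∃ m : ℕ, l = -(m + 1 : ℤ) := ⟨(-l - 1).toNat, by omega⟩
    exact hneg m
  · obtain ⟨m, rfl⟩ := Int.eq_ofNat_of_zero_le h
    exact hpos m

theorem isClockSeq_gaps {a : ℤ → ℝ} (ha : IsRingSeq a) : IsClockSeq (gaps a) := by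
  refine ⟨by simpa [gaps] using ha.nonneg, ?_, ?_, ?_⟩
  · intro i hi
    rw [gaps, if_neg hi]
    split_ifs with h1 h2
    · exact sub_pos.2 (ha.strictMono (by omega))
    · exact neg_pos.2 ha.neg
    · exact sub_pos.2 (ha.strictMono (by omega))
  · rw [← tendsto_add_atTop_iff_nat 1]
    have := ha.tendsto_atTop.comp (tendsto_natCast_atTop_atTop (R := ℤ))
    refine this.congr fun l => ?_
    rw [← ringTime_ofNat, ringTime_gaps]; rfl
  · rw [← tendsto_add_atTop_iff_nat 1]
    have h1 : Tendsto (fun l : ℕ => (-(l + 1 : ℤ))) atTop atBot :=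
      tendsto_neg_atTop_atBot.comp
        (tendsto_atTop_add_const_right _ 1 (tendsto_natCast_atTop_atTop (R := ℤ)))
    have := tendsto_neg_atBot_atTop.comp (ha.tendsto_atBot.comp h1)
    refine this.congr fun l => ?_
    have h2 := ringTime_negSucc (gaps a) l
    rw [ringTime_gaps] at h2
    simp only [Function.comp_apply, h2, neg_neg]

theorem isRingSeq_ringTime {ξ : ℤ → ℝ} (hξ : IsClockSeq ξ) : IsRingSeq (ringTime ξ) := by
  obtain ⟨h0, hpos, htop, hbot⟩ := hξ
  have hm1 : ringTime ξ (-1) = -ξ (-1) := by simpa using ringTime_negSucc ξ 0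
  have hz : ringTime ξ 0 = ξ 0 := by simpa using ringTime_ofNat ξ 0
  have hmono : StrictMono (ringTime ξ) := by
    refine strictMono_int_of_lt_succ fun l => ?_
    rcases lt_trichotomy l (-1) with h | h | h
    · obtain ⟨m, rfl⟩ : ∃ m : ℕ, l = -((m + 1 : ℕ) + 1 : ℤ) := ⟨(-l - 2).toNat, by omega⟩
      rw [show (-((m + 1 : ℕ) + 1 : ℤ) + 1) = -(m + 1 : ℤ) by push_cast; ring,
        ringTime_negSucc, ringTime_negSucc, Finset.sum_range_succ _ (m + 1)]
      have := hpos (-((m + 1 : ℕ) + 1 : ℤ)) (by omega)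
      linarith
    · subst h
      rw [show (-1 + 1 : ℤ) = 0 by norm_num, hm1, hz]
      have := hpos (-1) (by omega)
      linarith
    · obtain ⟨m, rfl⟩ := Int.eq_ofNat_of_zero_le (show 0 ≤ l by omega)
      rw [show ((m : ℤ) + 1) = ((m + 1 : ℕ) : ℤ) by push_cast; ring,
        ringTime_ofNat, ringTime_ofNat, Finset.sum_range_succ _ (m + 1)]
      have := hpos ((m + 1 : ℕ) : ℤ) (by omega)
      linarith
  refine ⟨hmono, ?_, hz ▸ h0, ?_, ?_⟩
  · rw [hm1]
    exact neg_neg_of_pos (hpos (-1) (by omega))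
  · refine tendsto_atTop_atTop.2 fun b => ?_
    obtain ⟨N, hN⟩ := ((tendsto_add_atTop_iff_nat 1).2 htop).eventually_ge_atTop b |>.exists
    exact ⟨N, fun l hl => hN.trans (hmono.monotone hl)⟩
  · refine tendsto_atBot_atBot.2 fun b => ?_
    obtain ⟨N, hN⟩ := ((tendsto_add_atTop_iff_nat 1).2 hbot).eventually_ge_atTop (-b) |>.exists
    refine ⟨-(N + 1 : ℤ), fun l hl => (hmono.monotone hl).trans ?_⟩
    rw [ringTime_negSucc]
    linarith

theorem exists_first_ring (ξ : ClockSpace) (t : ℝ) :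
    ∃ l₀ : ℤ, ringTime ξ.1 (l₀ - 1) - t < 0 ∧ 0 ≤ ringTime ξ.1 l₀ - t := by
  have h := isRingSeq_ringTime ξ.2
  obtain ⟨B, hB⟩ := (h.tendsto_atBot.eventually_lt_atBot t).exists
  have hbd : ∀ z : ℤ, t ≤ ringTime ξ.1 z → B ≤ z := fun z hz =>
    (h.strictMono.lt_iff_lt.1 (hB.trans_le hz)).le
  obtain ⟨l₀, hl₀, hmin⟩ := Int.exists_least_of_bdd ⟨B, hbd⟩
    (h.tendsto_atTop.eventually_ge_atTop t).exists
  refine ⟨l₀, ?_, sub_nonneg.2 hl₀⟩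
  by_contra hc
  have := hmin (l₀ - 1) (by linarith)
  omega

/-- The index `l_0` of the first ring at or after time `t`. -/
def firstRing (ξ : ClockSpace) (t : ℝ) : ℤ := (exists_first_ring ξ t).choose

theorem isRingSeq_shift (ξ : ClockSpace) (t : ℝ) :
    IsRingSeq fun l => ringTime ξ.1 (l + firstRing ξ t) - t := by
  have h := isRingSeq_ringTime ξ.2
  have hl := (exists_first_ring ξ t).choose_spec
  refine ⟨fun a b hab => sub_lt_sub_right (h.strictMono (by omega)) t, ?_, ?_, ?_, ?_⟩
  · rw [show -1 + firstRing ξ t = firstRing ξ t - 1 by ring]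
    exact hl.1
  · rw [zero_add]
    exact hl.2
  · exact tendsto_atTop_add_const_right _ (-t)
      (h.tendsto_atTop.comp (tendsto_atTop_add_const_right _ _ tendsto_id))
  · exact tendsto_atBot_add_const_right _ (-t)
      (h.tendsto_atBot.comp (tendsto_atBot_add_const_right _ _ tendsto_id))

/-- The shift on the sample space of a single clock: the origin of time is moved to `t`. -/
def clockShift (t : ℝ) (ξ : ClockSpace) : ClockSpace :=
  ⟨gaps fun l => ringTime ξ.1 (l + firstRing ξ t) - t, isClockSeq_gaps (isRingSeq_shift ξ t)⟩

theorem ringTime_clockShift (t : ℝ) (ξ : ClockSpace) (l : ℤ) :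
    ringTime (clockShift t ξ).1 l = ringTime ξ.1 (l + firstRing ξ t) - t := by
  rw [clockShift, ringTime_gaps]

/-! ### The random dynamical system -/

/-- The sample space: `n + 1` clocks, no two of which ever ring at the same time. -/
abbrev Sample (n : ℕ) : Type :=
  {ω : Fin (n + 1) → ClockSpace //
    ∀ k k' j j', k ≠ k' → ringTime (ω k).1 j ≠ ringTime (ω k').1 j'}

/-- The rates of the clocks: `α` for clock `0`, `β` for clock `n`, and `h k` for clock `k` with
`1 ≤ k ≤ n - 1`. -/
def rate (n : ℕ) (α β : ℝ) (h : ℕ → ℝ) (k : Fin (n + 1)) : ℝ :=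
  if (k : ℕ) = 0 then α else if (k : ℕ) = n then β else h k

/-- The probability measure on the sample space: the clocks are independent. -/
def prob (n : ℕ) (α β : ℝ) (h : ℕ → ℝ) : Measure (Sample n) :=
  (Measure.pi fun k => clockMeasure (rate n α β h k)).comap Subtype.val

/-- The time `T_{k,j}` of the `j`-th ring of clock `k`, for `p = (k, j)`. -/
def T {n : ℕ} (ω : Sample n) (p : Fin (n + 1) × ℤ) : ℝ := ringTime (ω.1 p.1).1 p.2

/-- The shift `θ_t` on the sample space. -/
def θ {n : ℕ} (t : ℝ) (ω : Sample n) : Sample n :=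
  ⟨fun k => clockShift t (ω.1 k), fun k k' j j' hk h => by
    rw [ringTime_clockShift, ringTime_clockShift] at h
    exact ω.2 k k' _ _ hk (sub_left_injective h)⟩

theorem T_injective {n : ℕ} (ω : Sample n) : Function.Injective (T ω) := by
  rintro ⟨k, j⟩ ⟨k', j'⟩ h
  by_cases hk : k = k'
  · subst hk
    have := (isRingSeq_ringTime (ω.1 k).2).strictMono.injective h
    simp_all
  · exact absurd h (ω.2 k k' j j' hk)

theorem finite_T_mem_Icc {n : ℕ} (ω : Sample n) (a b : ℝ) : {p | T ω p ∈ Icc a b}.Finite := by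
  have hk : ∀ k : Fin (n + 1), {j | T ω (k, j) ∈ Icc a b}.Finite := by
    intro k
    have h := isRingSeq_ringTime (ω.1 k).2
    obtain ⟨A, hA⟩ := (h.tendsto_atBot.eventually_lt_atBot a).exists
    obtain ⟨B, hB⟩ := (h.tendsto_atTop.eventually_gt_atTop b).exists
    refine (Set.finite_Icc A B).subset fun j hj => ⟨?_, ?_⟩
    · exact (h.strictMono.lt_iff_lt.1 (hA.trans_le hj.1)).le
    · exact (h.strictMono.lt_iff_lt.1 (hj.2.trans_lt hB)).le
  refine (Set.finite_iUnion fun k => (hk k).image (Prod.mk k)).subset ?_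
  rintro ⟨k, j⟩ h
  exact mem_iUnion.2 ⟨k, j, h, rfl⟩

theorem exists_enum {ι : Type} (f : ι → ℝ) (hf : Function.Injective f)
    (hfin : ∀ a b, {p | f p ∈ Icc a b}.Finite) (hup : ∀ x, ∃ p, x < f p)
    (hdown : ∀ x, ∃ p, f p < x) :
    ∃ σ : ℤ → ι, StrictMono (fun i => f (σ i)) ∧ Function.Surjective σ ∧
      f (σ (-1)) < 0 ∧ 0 ≤ f (σ 0) := by
  let _ : LinearOrder ι := LinearOrder.lift' f hf
  have hlt : ∀ p q : ι, p < q ↔ f p < f q := fun _ _ => Iff.rfl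
  let _ : LocallyFiniteOrder ι :=
    LocallyFiniteOrder.ofFiniteIcc fun p q => hfin (f p) (f q)
  obtain ⟨q, hq⟩ := hdown 0
  obtain ⟨r, hr⟩ := hup 0
  have : Nonempty ι := ⟨q⟩
  have : NoMaxOrder ι := ⟨fun p => (hup (f p)).imp fun _ h => (hlt _ _).2 h⟩
  have : NoMinOrder ι := ⟨fun p => (hdown (f p)).imp fun _ h => (hlt _ _).2 h⟩
  let _ : SuccOrder ι := LinearLocallyFiniteOrder.succOrder _
  let _ : PredOrder ι := LinearLocallyFiniteOrder.predOrder _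
  let e : ι ≃o ℤ := orderIsoIntOfLinearSuccPredArch
  have hmono : StrictMono fun i => f (e.symm i) := fun i j hij =>
    (hlt _ _).1 (e.symm.strictMono hij)
  obtain ⟨m, hm, hmin⟩ := Int.exists_least_of_bdd (P := fun i => 0 ≤ f (e.symm i))
    ⟨e q, fun z hz => by
      have : f (e.symm (e q)) < f (e.symm z) := by
        rw [e.symm_apply_apply]; exact hq.trans_le hz
      exact (hmono.lt_iff_lt.1 this).le⟩
    ⟨e r, by rw [e.symm_apply_apply]; exact hr.le⟩
  refine ⟨fun i => e.symm (i + m), fun i j hij => hmono (by omega), ?_, ?_, by simpa using hm⟩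
  · intro p
    exact ⟨e p - m, by simp⟩
  · by_contra hc
    have := hmin (-1 + m) (not_lt.1 hc)
    omega

/-- `σ` enumerates all pairs `(k, j)` in the order in which the corresponding rings occur,
where `σ 0` is the first ring at or after time `0`. -/
structure IsJumpEnum {n : ℕ} (ω : Sample n) (σ : ℤ → Fin (n + 1) × ℤ) : Prop where
  strictMono : StrictMono fun i => T ω (σ i)
  surjective : Function.Surjective σ
  neg : T ω (σ (-1)) < 0
  nonneg : 0 ≤ T ω (σ 0)

theorem exists_isJumpEnum {n : ℕ} (ω : Sample n) : ∃ σ, IsJumpEnum ω σ := by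
  have h := isRingSeq_ringTime (ω.1 0).2
  obtain ⟨σ, h1, h2, h3, h4⟩ := exists_enum (T ω) (T_injective ω) (finite_T_mem_Icc ω)
    (fun x => by
      obtain ⟨j, hj⟩ := (h.tendsto_atTop.eventually_gt_atTop x).exists
      exact ⟨(0, j), hj⟩)
    (fun x => by
      obtain ⟨j, hj⟩ := (h.tendsto_atBot.eventually_lt_atBot x).exists
      exact ⟨(0, j), hj⟩)
  exact ⟨σ, h1, h2, h3, h4⟩

/-- The index pairs `(k_i, j_i)` of the successive jumps. -/
def jumpEnum {n : ℕ} (ω : Sample n) : ℤ → Fin (n + 1) × ℤ := (exists_isJumpEnum ω).choose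

/-- The jump order sequence `k_i`. -/
def jumpSite {n : ℕ} (ω : Sample n) (i : ℤ) : Fin (n + 1) := (jumpEnum ω i).1

/-- The jump time sequence `t_i = T_{k_i, j_i}`. -/
def jumpTime {n : ℕ} (ω : Sample n) (i : ℤ) : ℝ := T ω (jumpEnum ω i)

/-- The cocycle `φ(t, x, ω)`. -/
def φ {n : ℕ} [NeZero n] (t : ℝ) (x : State n) (ω : Sample n) : State n :=
  tildePhi t x (jumpTime ω) (jumpSite ω)

/-- The event `Γ(t, t₀)` that all states at time `t₀` have been driven to the same state when the
time `t` has elapsed. -/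
def Γ (n : ℕ) [NeZero n] (t t₀ : ℝ) : Set (Sample n) :=
  {ω | ∀ x₁ x₂ : State n, φ t x₁ (θ t₀ ω) = φ t x₂ (θ t₀ ω)}

end TASEP

end

namespace TASEP

/-! There is one finite word of hops that empties the chain from every initial state: `n` sweeps
through the clocks `0, 1, …, n`. If the last `j` sites are empty, the next sweep carries any
particle in front of them all the way out, so the empty stretch at the right end grows by one site
per sweep (`SweepInv.hop`, `runHops_sweep`).

It remains to see that with positive probability the rings in `[0, t)` spell exactly this word. Cut
`[0, t)` into `n(n+1)` equal slots and ask that the `m`-th letter ring in slot `m`. This is forced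
by confining finitely many waiting times to nonempty open subsets of `(0, ∞)` (`isRingList_sweep`),
which for independent exponential variables has positive probability (`clockMeasure_box_pos`). The
restrictions defining the sample space cost only null sets.

Measurability: the finite list of rings in `[0, t)` determines `φ`, and there are countably many
lists. -/

/-! ### The cocycle as a function of the list of rings -/

/-- The state obtained from `x` by applying the hops listed in `L` successively. -/
def runHops {n : ℕ} [NeZero n] (x : State n) (L : List (Fin (n + 1) × ℤ)) : State n :=
  L.foldl (fun y p => hop y p.1) x

theorem runHops_map_range_succ {n : ℕ} [NeZero n] (x : State n) (σ : ℕ → Fin (n + 1) × ℤ) (m : ℕ) :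
    runHops x ((List.range (m + 1)).map σ) =
      hop (runHops x ((List.range m).map σ)) (σ m).1 := by
  simp [runHops, List.range_succ, List.foldl_append]

theorem iterHop_eq_runHops {n : ℕ} [NeZero n] (x : State n) (σ : ℤ → Fin (n + 1) × ℤ) (m : ℕ) :
    iterHop x (fun i => (σ i).1) 0 m =
      runHops x ((List.range m).map fun i : ℕ => σ i) := by
  induction m with
  | zero => rfl
  | succ m ih => rw [runHops_map_range_succ, iterHop, ih, add_zero]

/-- The normalisation of the enumeration at time `0` makes the infimum in `tildePhi` equal to `0`
and, for `m > 0`, the supremum equal to `m - 1`; for `m = 0` the default branch applies. -/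
theorem tildePhi_eq_iterHop {n : ℕ} [NeZero n] (t : ℝ) (x : State n) {ts : ℤ → ℝ}
    (ks : ℤ → Fin (n + 1)) (hts : StrictMono ts) (hneg : ts (-1) < 0) (hnn : 0 ≤ ts 0)
    {m : ℕ} (hm : ∀ i : ℤ, 0 ≤ i → (ts i < t ↔ i < m)) :
    tildePhi t x ts ks = iterHop x ks 0 m := by
  have h0 : ∀ i, 0 ≤ ts i ↔ 0 ≤ i := by
    intro i
    refine ⟨fun h => ?_, fun h => hnn.trans (hts.monotone h)⟩
    have := hts.lt_iff_lt.1 (hneg.trans_le h)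
    omega
  unfold tildePhi
  rcases Nat.eq_zero_or_pos m with rfl | hpos
  · rw [if_pos]
    · rfl
    · rintro i ⟨h1, h2⟩
      have h3 := (h0 i).1 h1
      have := (hm i h3).1 h2
      simp at this
      omega
  · rw [if_neg]
    · have e0 : sInf {i | 0 ≤ ts i} = 0 :=
        IsLeast.csInf_eq ⟨hnn, fun i hi => (h0 i).1 hi⟩
      have e1 : sSup {i | ts i < t} = m - 1 := by
        refine IsGreatest.csSup_eq ⟨(hm _ (by omega)).2 (by omega), fun i hi => ?_⟩
        rcases lt_or_ge i 0 with h | h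
        · omega
        · have := (hm i h).1 hi
          omega
      simp only [e0, e1]
      congr 1
      omega
    · intro h
      exact h 0 ⟨hnn, (hm 0 le_rfl).2 (by omega)⟩

/-- `L` lists the rings that occur in `[0, t)` in increasing order. -/
def IsRingList {n : ℕ} (t : ℝ) (ω : Sample n) (L : List (Fin (n + 1) × ℤ)) : Prop :=
  L.Pairwise (fun p q => T ω p < T ω q) ∧ ∀ p, T ω p ∈ Ico 0 t ↔ p ∈ L

/-- Two strictly increasing lists with the same members agree. Thus any explicitly known ring list
computes `φ`, whatever enumeration `jumpEnum` chose. -/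
theorem IsRingList.unique {n : ℕ} {t : ℝ} {ω : Sample n} {L L' : List (Fin (n + 1) × ℤ)}
    (h : IsRingList t ω L) (h' : IsRingList t ω L') : L = L' := by
  have nd : ∀ {K : List (Fin (n + 1) × ℤ)}, K.Pairwise (fun p q => T ω p < T ω q) → K.Nodup :=
    fun hK => hK.imp fun {a b} hab e => by subst e; exact lt_irrefl _ hab
  refine List.Perm.eq_of_pairwise (le := fun p q => T ω p < T ω q)
    (fun a b _ _ h1 h2 => absurd h1 h2.asymm) h.1 h'.1 ?_
  exact (List.perm_ext_iff_of_nodup (nd h.1) (nd h'.1)).2 fun p => by rw [← h.2, ← h'.2]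

theorem exists_isRingList {n : ℕ} [NeZero n] (t : ℝ) (ω : Sample n) :
    ∃ L, IsRingList t ω L ∧ ∀ x, φ t x ω = runHops x L := by
  have he : IsJumpEnum ω (jumpEnum ω) := (exists_isJumpEnum ω).choose_spec
  have hmono : StrictMono (jumpTime ω) := he.strictMono
  have hneg : jumpTime ω (-1) < 0 := he.neg
  have hnn : 0 ≤ jumpTime ω 0 := he.nonneg
  obtain ⟨m, hm⟩ : ∃ m : ℕ, ∀ i : ℤ, 0 ≤ i → (jumpTime ω i < t ↔ i < m) := by
    -- Otherwise infinitely many rings would fall in `[0, t]`, against local finiteness.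
    have hex : ∃ i : ℕ, t ≤ jumpTime ω i := by
      by_contra! hc
      have hinj : Function.Injective fun i : ℕ => jumpEnum ω i := fun a b hab =>
        Nat.cast_injective (R := ℤ) (hmono.injective (congrArg (T ω) hab))
      refine Set.infinite_range_of_injective hinj ((finite_T_mem_Icc ω 0 t).subset ?_)
      rintro _ ⟨i, rfl⟩
      exact ⟨hnn.trans (hmono.monotone (Int.natCast_nonneg i)), (hc i).le⟩
    classical
    refine ⟨Nat.find hex, fun i hi => ?_⟩
    obtain ⟨j, rfl⟩ := Int.eq_ofNat_of_zero_le hi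
    refine ⟨fun h => ?_, fun h => ?_⟩
    · by_contra hc
      exact absurd h (not_lt.2 ((Nat.find_spec hex).trans (hmono.monotone (not_lt.1 hc))))
    · exact not_le.1 (Nat.find_min hex (by exact_mod_cast h))
  refine ⟨(List.range m).map fun i : ℕ => jumpEnum ω i, ⟨?_, fun p => ?_⟩, fun x => ?_⟩
  · rw [List.pairwise_map]
    exact List.pairwise_lt_range.imp fun {a b} hab => hmono (by exact_mod_cast hab)
  · obtain ⟨i, rfl⟩ := he.surjective p
    simp only [List.mem_map, List.mem_range]
    constructor
    · rintro ⟨h1, h2⟩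
      have h3 : -1 < i := hmono.lt_iff_lt.1 (hneg.trans_le h1)
      obtain ⟨j, rfl⟩ := Int.eq_ofNat_of_zero_le (show 0 ≤ i by omega)
      exact ⟨j, by exact_mod_cast (hm j (by omega)).1 h2, rfl⟩
    · rintro ⟨j, hj, hji⟩
      rw [← hji]
      exact ⟨hnn.trans (hmono.monotone (Int.natCast_nonneg j)),
        (hm j (by omega)).2 (by exact_mod_cast hj)⟩
  · rw [← iterHop_eq_runHops]
    exact tildePhi_eq_iterHop t x _ hmono hneg hnn hm

theorem φ_eq_runHops {n : ℕ} [NeZero n] {t : ℝ} {ω : Sample n} {L : List (Fin (n + 1) × ℤ)}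
    (h : IsRingList t ω L) (x : State n) : φ t x ω = runHops x L := by
  obtain ⟨L', h', hφ⟩ := exists_isRingList t ω
  rw [hφ, h.unique h']

/-! ### The shift by zero -/

theorem ringTime_injective : Function.Injective ringTime := by
  intro ξ η h
  have key : ∀ f g : ℕ → ℝ, (∀ l, ∑ i ∈ Finset.range (l + 1), f i =
      ∑ i ∈ Finset.range (l + 1), g i) → ∀ l, f l = g l := by
    intro f g hfg l
    have h0 : ∀ l, ∑ i ∈ Finset.range l, f i = ∑ i ∈ Finset.range l, g i := by
      rintro (_ | l)
      · simp
      · exact hfg l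
    have h1 := h0 (l + 1)
    rw [Finset.sum_range_succ, Finset.sum_range_succ, h0 l] at h1
    exact add_left_cancel h1
  funext i
  rcases lt_or_ge i 0 with hi | hi
  · obtain ⟨m, rfl⟩ : ∃ m : ℕ, i = -(m + 1 : ℤ) := ⟨(-i - 1).toNat, by omega⟩
    refine key (fun m => ξ (-(m + 1 : ℤ))) (fun m => η (-(m + 1 : ℤ))) (fun l => ?_) m
    have := congrFun h (-(l + 1 : ℤ))
    rw [ringTime_negSucc, ringTime_negSucc] at this
    exact neg_injective this
  · obtain ⟨m, rfl⟩ := Int.eq_ofNat_of_zero_le hi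
    exact key (fun m => ξ m) (fun m => η m) (fun l => congrFun h (l : ℤ)) m

/-- Although `firstRing` is a choice, strict monotonicity forces it to be `0` here. -/
theorem clockShift_zero (ξ : ClockSpace) : clockShift 0 ξ = ξ := by
  have h := isRingSeq_ringTime ξ.2
  have hl : ringTime ξ.1 (firstRing ξ 0 - 1) - 0 < 0 ∧ 0 ≤ ringTime ξ.1 (firstRing ξ 0) - 0 :=
    (exists_first_ring ξ 0).choose_spec
  have h0 : firstRing ξ 0 = 0 := by
    have h1 := h.strictMono.lt_iff_lt.1 (h.neg.trans_le (by simpa using hl.2))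
    have h2 := h.strictMono.lt_iff_lt.1 ((show _ < (0 : ℝ) by simpa using hl.1).trans_le h.nonneg)
    omega
  refine Subtype.ext (ringTime_injective (funext fun l => ?_))
  rw [ringTime_clockShift, h0, add_zero, sub_zero]

theorem θ_zero {n : ℕ} (ω : Sample n) : θ 0 ω = ω :=
  Subtype.ext (funext fun _ => clockShift_zero _)

theorem mem_Γ_zero_iff {n : ℕ} [NeZero n] {t : ℝ} {ω : Sample n} {L : List (Fin (n + 1) × ℤ)}
    (h : IsRingList t ω L) :
    ω ∈ Γ n t 0 ↔ ∀ x₁ x₂ : State n, runHops x₁ L = runHops x₂ L := by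
  simp only [Γ, mem_ofPred_eq, θ_zero, φ_eq_runHops h]

/-! ### Measurability -/

theorem measurable_ringTime (j : ℤ) : Measurable fun ξ : ℤ → ℝ => ringTime ξ j := by
  cases j <;> simp only [ringTime] <;> fun_prop

theorem measurable_T {n : ℕ} (p : Fin (n + 1) × ℤ) : Measurable fun ω : Sample n => T ω p :=
  (measurable_ringTime p.2).comp
    (measurable_subtype_coe.comp ((measurable_pi_apply p.1).comp measurable_subtype_coe))

theorem measurableSet_isRingList {n : ℕ} (t : ℝ) (L : List (Fin (n + 1) × ℤ)) :
    MeasurableSet {ω : Sample n | IsRingList t ω L} := by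
  refine MeasurableSet.inter ?_ ?_
  · change MeasurableSet {ω : Sample n | L.Pairwise (fun p q => T ω p < T ω q)}
    induction L with
    | nil => simp
    | cons a L ih =>
      simp only [List.pairwise_cons]
      refine MeasurableSet.inter ?_ ih
      change MeasurableSet {ω : Sample n | ∀ p ∈ L, T ω a < T ω p}
      rw [ofPred_forall]
      refine MeasurableSet.iInter fun p => ?_
      rw [ofPred_forall]
      exact MeasurableSet.iInter fun _ => measurableSet_lt (measurable_T a) (measurable_T p)
  · change MeasurableSet {ω : Sample n | ∀ p, T ω p ∈ Ico 0 t ↔ p ∈ L}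
    rw [ofPred_forall]
    exact MeasurableSet.iInter fun p =>
      (measurable_T p measurableSet_Ico).iff (MeasurableSet.const _)

/-- Splitting by the ring list avoids any measurability question about the chosen enumeration
`jumpEnum`. -/
theorem measurableSet_Γ_zero (n : ℕ) [NeZero n] (t : ℝ) : MeasurableSet (Γ n t 0) := by
  have : Γ n t 0 = ⋃ L ∈ {L | ∀ x₁ x₂ : State n, runHops x₁ L = runHops x₂ L},
      {ω | IsRingList t ω L} := by
    ext ω
    simp only [mem_iUnion, mem_ofPred_eq, exists_prop]
    obtain ⟨L, hL, -⟩ := exists_isRingList t ω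
    exact ⟨fun h => ⟨L, (mem_Γ_zero_iff hL).1 h, hL⟩, fun ⟨L', h, hL'⟩ => (mem_Γ_zero_iff hL').2 h⟩
  rw [this]
  exact MeasurableSet.biUnion (to_countable _) fun L _ => measurableSet_isRingList t L

/-! ### A coalescing sequence of hops -/

/-- The successive hops of sweeps through all clocks in the order `0, 1, …, n`. -/
def sweep (n : ℕ) (m : ℕ) : Fin (n + 1) × ℤ :=
  (⟨m % (n + 1), Nat.mod_lt _ n.succ_pos⟩, (m / (n + 1) : ℕ))

theorem sweep_mul_add {n j k : ℕ} (hk : k < n + 1) :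
    sweep n (j * (n + 1) + k) = (⟨k, hk⟩, (j : ℤ)) := by
  have h1 : (j * (n + 1) + k) % (n + 1) = k := by
    rw [mul_comm, Nat.mul_add_mod, Nat.mod_eq_of_lt hk]
  have h2 : (j * (n + 1) + k) / (n + 1) = j := by
    rw [mul_comm, Nat.mul_add_div n.succ_pos, Nat.div_eq_of_lt hk, add_zero]
  simp [sweep, h1, h2]

/-- After `j` sweeps and the first `k` hops of the next one, the last `j` sites are empty except
for the target of the last hop, and so is the site in front of them once it has been served. -/
def SweepInv {n : ℕ} (x : State n) (j k : ℕ) : Prop :=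
  ∀ i : Fin n, (n ≤ i + j ∨ (n ≤ i + 1 + j ∧ n + 1 ≤ k + j)) → (i : ℕ) + 1 ≠ k → x i = false

theorem SweepInv.hop {n : ℕ} [NeZero n] {x : State n} {j k : ℕ} (h : SweepInv x j k)
    (hk : k < n + 1) : SweepInv (hop x ⟨k, hk⟩) j (k + 1) := by
  intro i hi hik
  have hil := i.isLt
  unfold TASEP.hop
  dsimp only
  split_ifs with h0 hn hab
  · subst h0
    rw [Function.update_of_ne (by rw [Ne, Fin.ext_iff]; dsimp only; omega)]
    exact h i (by omega) (by omega)
  · by_cases hin : (i : ℕ) = n - 1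
    · rw [show i = ⟨n - 1, by omega⟩ from Fin.ext hin, Function.update_self]
    · rw [Function.update_of_ne (by rw [Ne, Fin.ext_iff]; exact hin)]
      exact h i (by omega) (by omega)
  · rw [Function.update_of_ne (by rw [Ne, Fin.ext_iff]; dsimp only; omega)]
    by_cases hia : (i : ℕ) = k - 1
    · rw [show i = ⟨k - 1, by omega⟩ from Fin.ext hia, Function.update_self]
    · rw [Function.update_of_ne (by rw [Ne, Fin.ext_iff]; exact hia)]
      exact h i (by omega) (by omega)
  · by_cases hia : (i : ℕ) = k - 1
    -- The site ahead is empty by the invariant, so the hop is not blocked: if it does nothing, its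
    -- source was already empty.
    · have hb := h ⟨k, by omega⟩ (by dsimp only; omega) (by dsimp only; omega)
      have hie : i = ⟨k - 1, by omega⟩ := Fin.ext hia
      rw [hie]
      simpa [hb] using hab
    · exact h i (by omega) (by omega)

theorem sweepInv_runHops {n : ℕ} [NeZero n] (x : State n) (j k : ℕ) (hk : k ≤ n + 1) :
    SweepInv (runHops x ((List.range (j * (n + 1) + k)).map (sweep n))) j k := by
  have step : ∀ j, SweepInv (runHops x ((List.range (j * (n + 1))).map (sweep n))) j 0 →
      ∀ k ≤ n + 1, SweepInv (runHops x ((List.range (j * (n + 1) + k)).map (sweep n))) j k := by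
    intro j hj k
    induction k with
    | zero => exact fun _ => hj
    | succ k ih =>
      intro hk
      rw [← add_assoc, runHops_map_range_succ, sweep_mul_add (by omega)]
      exact (ih (by omega)).hop (by omega)
  refine step j ?_ k hk
  induction j with
  | zero =>
    intro i hi
    have := i.isLt
    omega
  | succ j ih =>
    rw [add_mul, one_mul]
    intro i hi _
    have := i.isLt
    -- At `k = n + 1` the exempted target lies beyond the chain, and the site in front has been
    -- served: this is the invariant for `j + 1`.
    exact step j ih (n + 1) le_rfl i (by omega) (by omega)

theorem runHops_sweep {n : ℕ} [NeZero n] (x : State n) :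
    runHops x ((List.range (n * (n + 1))).map (sweep n)) = fun _ => false := by
  funext i
  exact sweepInv_runHops x n 0 (by omega) i (by omega) (by omega)

/-! ### A configuration of the clocks that rings in sweeps -/

/-- The windows for the variables `ξ_0, …, ξ_n` of clock `k`. -/
def window (n : ℕ) (t : ℝ) (k : ℕ) (i : ℕ) : Set ℝ :=
  let d : ℝ := t / (n * (n + 1))
  if i = n then Ioi t else if i = 0 then Ioo (k * d) (k * d + d / n)
    else Ioo ((n + 1) * d) ((n + 1) * d + d / n)

/-- With `d = t / (n(n+1))`, each waiting time exceeds its nominal value (`k d` first, then one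
sweep length `(n+1) d`) by less than `d / n`; these errors add up. -/
theorem ringTime_mem_of_window {n : ℕ} [NeZero n] {t : ℝ} {k : ℕ} {ξ : ℤ → ℝ}
    (hξ : ∀ i : ℕ, i ≤ n → ξ i ∈ window n t k i) (j : ℕ) (hj : j < n) :
    ringTime ξ j ∈ Ioo ((j * (n + 1) + k : ℝ) * (t / (n * (n + 1))))
      ((j * (n + 1) + k : ℝ) * (t / (n * (n + 1))) + (j + 1) * (t / (n * (n + 1)) / n)) := by
  set d : ℝ := t / (n * (n + 1)) with hd
  induction j with
  | zero =>
    have := hξ 0 (by omega)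
    simp only [window, if_neg (show 0 ≠ n by omega), if_true] at this
    rw [ringTime_ofNat]
    simpa using this
  | succ j ih =>
    have h1 := hξ (j + 1) (by omega)
    simp only [window, if_neg (show j + 1 ≠ n by omega), if_neg (Nat.succ_ne_zero j)] at h1
    have h2 := ih (by omega)
    rw [ringTime_ofNat] at h2 ⊢
    rw [Finset.sum_range_succ]
    rw [← hd] at h1
    push_cast at h1 ⊢
    constructor <;> nlinarith [h1.1, h1.2, h2.1, h2.2]

theorem isRingList_sweep {n : ℕ} [NeZero n] {t : ℝ} (ht : 0 < t) {ω : Sample n}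
    (hω : ∀ k : Fin (n + 1), ∀ i : ℕ, i ≤ n → (ω.1 k).1 i ∈ window n t k i) :
    IsRingList t ω ((List.range (n * (n + 1))).map (sweep n)) := by
  have hn : (0 : ℝ) < n := by exact_mod_cast NeZero.pos n
  obtain ⟨d, hd⟩ : ∃ d : ℝ, d = t / (n * (n + 1)) := ⟨_, rfl⟩
  have hdpos : 0 < d := by rw [hd]; positivity
  have htd : t = (n * (n + 1) : ℝ) * d := by rw [hd]; field_simp
  have hT : ∀ m < n * (n + 1), T ω (sweep n m) ∈ Ioo ((m : ℝ) * d) ((m + 1 : ℝ) * d) := by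
    intro m hm
    have hdiv : m / (n + 1) < n := Nat.div_lt_of_lt_mul (by rwa [mul_comm])
    have h := ringTime_mem_of_window (hω (sweep n m).1) (m / (n + 1)) hdiv
    rw [← hd] at h
    have hm' : ((m / (n + 1) : ℕ) * (n + 1) + ((sweep n m).1 : ℕ) : ℝ) = m := by
      have := Nat.div_add_mod m (n + 1)
      simp only [sweep]
      rw [mul_comm]
      exact_mod_cast this
    rw [hm'] at h
    refine ⟨h.1, h.2.trans_le ?_⟩
    -- At most `n` errors below `d / n` accumulate, so the ring stays inside its slot of length `d`.
    have h3 : ((m / (n + 1) : ℕ) + 1 : ℝ) ≤ n := by exact_mod_cast hdiv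
    have h4 : ((m / (n + 1) : ℕ) + 1 : ℝ) * (d / n) ≤ n * (d / n) := by gcongr
    rw [mul_div_cancel₀ _ hn.ne'] at h4
    linarith
  refine ⟨?_, ?_⟩
  · rw [List.pairwise_map]
    refine List.pairwise_lt_range.imp_of_mem fun {a b} ha hb hab => ?_
    rw [List.mem_range] at ha hb
    refine (hT a ha).2.trans ((hT b hb).1.trans_le' ?_)
    have : (a + 1 : ℝ) ≤ b := by exact_mod_cast hab
    gcongr
  · rintro ⟨k, j⟩
    simp only [List.mem_map, List.mem_range]
    constructor
    · rintro ⟨h1, h2⟩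
      have hr := isRingSeq_ringTime (ω.1 k).2
      have hj0 : -1 < j := hr.strictMono.lt_iff_lt.1 (hr.neg.trans_le h1)
      obtain ⟨j, rfl⟩ := Int.eq_ofNat_of_zero_le (show 0 ≤ j by omega)
      -- Ring `n` of a clock comes after `ξ_n > t`, so only rings `0, …, n - 1` can occur before
      -- `t`.
      have hjn : j < n := by
        by_contra hc
        have h3 : ringTime (ω.1 k).1 (n : ℤ) ≤ T ω (k, (j : ℤ)) :=
          hr.strictMono.monotone (by omega)
        have h4 := hω k n le_rfl
        simp only [window, if_true, mem_Ioi] at h4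
        rw [ringTime_ofNat] at h3
        have h5 := Finset.single_le_sum (f := fun i : ℕ => (ω.1 k).1 (i : ℤ))
          (s := Finset.range (n + 1)) (fun i _ => ?_) (Finset.self_mem_range_succ n)
        · linarith
        · rcases eq_or_ne (i : ℤ) 0 with h | h
          · rw [h]
            exact (ω.1 k).2.1
          · exact ((ω.1 k).2.2.1 _ h).le
      refine ⟨j * (n + 1) + k, ?_, sweep_mul_add k.isLt⟩
      have := k.isLt
      nlinarith
    · rintro ⟨m, hm, hmk⟩
      rw [← hmk]
      have h := hT m hm
      refine ⟨h.1.le.trans' (by positivity), h.2.trans_le ?_⟩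
      rw [htd]
      have : (m + 1 : ℝ) ≤ n * (n + 1) := by exact_mod_cast hm
      gcongr

theorem mem_Γ_zero_of_window {n : ℕ} [NeZero n] {t : ℝ} (ht : 0 < t) {ω : Sample n}
    (hω : ∀ k : Fin (n + 1), ∀ i : ℕ, i ≤ n → (ω.1 k).1 i ∈ window n t k i) : ω ∈ Γ n t 0 :=
  (mem_Γ_zero_iff (isRingList_sweep ht hω)).2 fun x₁ x₂ => by rw [runHops_sweep, runHops_sweep]

/-! ### Almost sure properties of the clocks -/

theorem measure_eq_zero_of_indepFun {Ω : Type*} [MeasurableSpace Ω] {μ : Measure Ω}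
    [IsProbabilityMeasure μ] {X Y : Ω → ℝ} (hX : Measurable X) (hY : Measurable Y)
    (hXY : IndepFun X Y μ) (h0 : ∀ c, μ {ω | X ω = c} = 0) : μ {ω | X ω = Y ω} = 0 := by
  have hd : MeasurableSet {p : ℝ × ℝ | p.2 = p.1} :=
    measurableSet_eq_fun measurable_snd measurable_fst
  -- Fubini with `Y` as first coordinate: each slice fixes the value of `Y`, and `X` has no atoms.
  have h1 : μ {ω | X ω = Y ω} = μ.map (fun ω => (Y ω, X ω)) {p : ℝ × ℝ | p.2 = p.1} := by
    rw [Measure.map_apply (hY.prodMk hX) hd]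
    rfl
  have := Measure.isProbabilityMeasure_map (μ := μ) hX.aemeasurable
  have := Measure.isProbabilityMeasure_map (μ := μ) hY.aemeasurable
  rw [h1, (indepFun_iff_map_prod_eq_prod_map_map hY.aemeasurable hX.aemeasurable).1 hXY.symm,
    Measure.measure_prod_null hd]
  refine Eventually.of_forall fun c => ?_
  exact (Measure.map_apply hX (hd.preimage measurable_prodMk_left)).trans (h0 c)

/-- Restricting to an almost sure property loses no mass. The property need not be measurable: being
conull makes it null measurable. -/
theorem comap_subtype_val_preimage {α : Type*} [MeasurableSpace α] {μ : Measure α} {p : α → Prop}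
    (hp : ∀ᵐ x ∂μ, p x) {s : Set α} (hs : MeasurableSet s) :
    μ.comap (Subtype.val : {x // p x} → α) (Subtype.val ⁻¹' s) = μ s := by
  have hn : NullMeasurableSet {x | p x} μ := by
    refine NullMeasurableSet.congr nullMeasurableSet_univ ?_
    filter_upwards [hp] with x hx
    exact propext ⟨fun _ => hx, fun _ => trivial⟩
  refine (Measure.comap_apply₀ _ _ Subtype.val_injective
    (fun t ht => Measure.MeasurableSet.nullMeasurableSet_subtype_coe hn ht)
    (measurable_subtype_coe hs).nullMeasurableSet).trans (measure_congr ?_)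
  filter_upwards [hp] with x hx
  refine propext ⟨?_, fun h => ⟨⟨x, hx⟩, h, rfl⟩⟩
  rintro ⟨y, hy, rfl⟩
  exact hy

theorem expMeasure_singleton (r c : ℝ) : expMeasure r {c} = 0 := by
  rw [expMeasure, gammaMeasure]
  exact measure_singleton c

theorem expMeasure_pos {r : ℝ} (hr : 0 < r) {s : Set ℝ} (hs : IsOpen s) (hne : s.Nonempty)
    (hpos : s ⊆ Ioi 0) : 0 < expMeasure r s := by
  rw [expMeasure, gammaMeasure, pos_iff_ne_zero, Ne,
    withDensity_apply_eq_zero (by unfold gammaPDF; fun_prop)]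
  have : {x | gammaPDF 1 r x ≠ 0} ∩ s = s := by
    refine inter_eq_right.2 fun x hx => ?_
    exact (ENNReal.ofReal_pos.2 (gammaPDFReal_pos one_pos hr (hpos hx))).ne'
  rw [this]
  exact (hs.measure_pos _ hne).ne'

theorem expMeasure_Iic_zero (r : ℝ) : expMeasure r (Iic 0) = 0 := by
  rw [← Iio_union_right, measure_union_null_iff]
  refine ⟨?_, expMeasure_singleton r 0⟩
  rw [expMeasure, gammaMeasure, withDensity_apply _ measurableSet_Iio]
  exact lintegral_gammaPDF_of_nonpos le_rfl

section

variable {r : ℝ} [IsProbabilityMeasure (expMeasure r)]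

theorem ae_pos (i : ℤ) : ∀ᵐ ξ ∂Measure.infinitePi fun _ : ℤ => expMeasure r, 0 < ξ i := by
  have h : ∀ᵐ x ∂expMeasure r, 0 < x := by
    rw [ae_iff]
    simp only [not_lt]
    exact expMeasure_Iic_zero r
  exact (measurePreserving_eval_infinitePi (fun _ : ℤ => expMeasure r) i).quasiMeasurePreserving.ae h

theorem iIndepFun_eval {g : ℕ → ℤ} (hg : Function.Injective g) :
    iIndepFun (fun i (ξ : ℤ → ℝ) => ξ (g i)) (Measure.infinitePi fun _ : ℤ => expMeasure r) :=
  (iIndepFun_infinitePi (P := fun _ : ℤ => expMeasure r) (X := fun _ x => x)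
    fun _ => measurable_id).precomp hg

/-- By the second Borel–Cantelli lemma infinitely many terms exceed `1`, so the positive series
diverges. A general injective `g` serves both halves of the clock. -/
theorem ae_tendsto_sum (hr : 0 < r) {g : ℕ → ℤ} (hg : Function.Injective g) :
    ∀ᵐ ξ ∂Measure.infinitePi fun _ : ℤ => expMeasure r,
      Tendsto (fun N : ℕ => ∑ i ∈ Finset.range N, ξ (g i)) atTop atTop := by
  set μ := Measure.infinitePi fun _ : ℤ => expMeasure r
  let s : ℕ → Set (ℤ → ℝ) := fun i => {ξ | 1 < ξ (g i)}
  have hsm : ∀ i, MeasurableSet (s i) := fun i =>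
    measurableSet_lt measurable_const (measurable_pi_apply _)
  have hind : iIndepSet s μ := (iIndepSet_iff_meas_biInter hsm).2 fun S =>
    (iIndepFun_eval hg).meas_biInter fun i _ => ⟨Ioi 1, measurableSet_Ioi, rfl⟩
  have hμ : ∀ i, μ (s i) = expMeasure r (Ioi 1) := fun i =>
    (measurePreserving_eval_infinitePi (fun _ : ℤ => expMeasure r) (g i)).measure_preimage
      measurableSet_Ioi.nullMeasurableSet
  have hlim : ∀ᵐ ξ ∂μ, ξ ∈ limsup s atTop := by
    refine (mem_ae_iff_prob_eq_one (MeasurableSet.measurableSet_limsup hsm)).2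
      (measure_limsup_eq_one hsm hind ?_)
    simp only [hμ]
    exact ENNReal.tsum_const_eq_top_of_ne_zero
      (expMeasure_pos hr isOpen_Ioi nonempty_Ioi (Ioi_subset_Ioi zero_le_one)).ne'
  filter_upwards [hlim, ae_all_iff.2 fun i => ae_pos (r := r) (g i)] with ξ h1 h2
  rw [← not_summable_iff_tendsto_nat_atTop_of_nonneg fun i => (h2 i).le]
  intro hsum
  have h3 := hsum.tendsto_atTop_zero.eventually_lt_const one_pos
  rw [mem_limsup_iff_frequently_mem] at h1
  obtain ⟨i, h4, h5⟩ := (h1.and_eventually h3).exists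
  exact lt_asymm h4 h5

theorem ae_isClockSeq (hr : 0 < r) :
    ∀ᵐ ξ ∂Measure.infinitePi fun _ : ℤ => expMeasure r, IsClockSeq ξ := by
  filter_upwards [ae_all_iff.2 fun i => ae_pos (r := r) i,
    ae_tendsto_sum hr Nat.cast_injective,
    ae_tendsto_sum hr (g := fun i => -(i + 1 : ℤ)) fun a b hab => by dsimp only at hab; omega]
    with ξ h1 h2 h3
  exact ⟨(h1 0).le, fun i _ => h1 i, h2, h3⟩

/-- One summand, `ξ (g 0)`, is atomless and independent of `c` minus the others, so the two coincide
with probability zero. -/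
theorem infinitePi_sum_eq (l : ℕ) {g : ℕ → ℤ} (hg : Function.Injective g) (c : ℝ) :
    Measure.infinitePi (fun _ : ℤ => expMeasure r)
      {ξ | ∑ i ∈ Finset.range (l + 1), ξ (g i) = c} = 0 := by
  have hind := ((iIndepFun_eval (r := r) hg).indepFun_finsetSum_of_notMem
    (fun i => measurable_pi_apply _) (s := (Finset.range (l + 1)).erase 0) (i := 0) (by simp)).symm
  have hm : Measurable fun ξ : ℤ → ℝ => ∑ i ∈ (Finset.range (l + 1)).erase 0, ξ (g i) := by fun_prop
  have h := measure_eq_zero_of_indepFun (measurable_pi_apply (g 0)) (hm.const_sub c)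
    (hind.comp measurable_id (measurable_const_sub c) |>.congr ?_ ?_) fun d => ?_
  · refine measure_mono_null (fun ξ hξ => ?_) h
    rw [mem_ofPred_eq, ← Finset.add_sum_erase _ _ (Finset.mem_range.2 l.succ_pos)] at hξ
    exact eq_sub_of_add_eq hξ
  · exact Eventually.of_forall fun ξ => rfl
  · exact Eventually.of_forall fun ξ => by simp [Finset.sum_apply]
  · exact ((measurePreserving_eval_infinitePi (fun _ : ℤ => expMeasure r) (g 0)).measure_preimage
      (measurableSet_singleton d).nullMeasurableSet).trans (expMeasure_singleton r d)

theorem infinitePi_ringTime_eq (j : ℤ) (c : ℝ) :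
    Measure.infinitePi (fun _ : ℤ => expMeasure r) {ξ | ringTime ξ j = c} = 0 := by
  cases j with
  | ofNat l => exact infinitePi_sum_eq l Nat.cast_injective c
  | negSucc l =>
    have := infinitePi_sum_eq (r := r) l (g := fun i => -(i + 1 : ℤ))
      (fun a b hab => by dsimp only at hab; omega) (-c)
    simpa only [ringTime, neg_eq_iff_eq_neg] using this

end

theorem isProbabilityMeasure_clockMeasure {r : ℝ} (hr : 0 < r) :
    IsProbabilityMeasure (clockMeasure r) := by
  have := isProbabilityMeasure_expMeasure hr
  refine ⟨?_⟩
  have h := comap_subtype_val_preimage (ae_isClockSeq hr) MeasurableSet.univ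
  rw [preimage_univ] at h
  exact h.trans measure_univ

theorem clockMeasure_ringTime_eq {r : ℝ} (hr : 0 < r) (j : ℤ) (c : ℝ) :
    clockMeasure r {ξ | ringTime ξ.1 j = c} = 0 := by
  have := isProbabilityMeasure_expMeasure hr
  exact (comap_subtype_val_preimage (ae_isClockSeq hr)
    (measurable_ringTime j (measurableSet_singleton c))).trans (infinitePi_ringTime_eq j c)

theorem clockMeasure_box_pos {r : ℝ} (hr : 0 < r) (m : ℕ) {W : ℕ → Set ℝ}
    (hW : ∀ i, IsOpen (W i)) (hne : ∀ i, (W i).Nonempty) (hpos : ∀ i, W i ⊆ Ioi 0) :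
    0 < clockMeasure r {ξ | ∀ i : ℕ, i ≤ m → ξ.1 i ∈ W i} := by
  have := isProbabilityMeasure_expMeasure hr
  let S : Set (ℤ → ℝ) :=
    -- Only casts of naturals occur as coordinates here, so `toNat` recovers the index of the
    -- window.
    Set.pi (((Finset.range (m + 1)).map Nat.castEmbedding : Finset ℤ) : Set ℤ) fun i => W i.toNat
  have hWm : ∀ i, MeasurableSet (W i) := fun i => (hW i).measurableSet
  have hS : MeasurableSet S := MeasurableSet.pi (Finset.countable_toSet _) fun i _ => hWm _
  have he : {ξ : ClockSpace | ∀ i : ℕ, i ≤ m → ξ.1 i ∈ W i} = Subtype.val ⁻¹' S := by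
    ext ξ
    simp [S, Set.mem_pi]
  rw [he, clockMeasure, comap_subtype_val_preimage (ae_isClockSeq hr) hS,
    Measure.infinitePi_pi _ fun i _ => hWm _, CanonicallyOrderedAdd.prod_pos]
  exact fun i _ => expMeasure_pos hr (hW _) (hne _) (hpos _)

/-- Only countably many pairs of rings can collide, and each collision is null by independence and
the absence of atoms. -/
theorem ae_ringTime_ne {n : ℕ} {r : Fin (n + 1) → ℝ} (hr : ∀ k, 0 < r k) :
    ∀ᵐ ω ∂Measure.pi fun k => clockMeasure (r k),
      ∀ k k' j j', k ≠ k' → ringTime (ω k).1 j ≠ ringTime (ω k').1 j' := by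
  have := fun k => isProbabilityMeasure_clockMeasure (hr k)
  simp only [ae_all_iff]
  intro k k' j j' hk
  have hm : ∀ (j : ℤ), Measurable fun ξ : ClockSpace => ringTime ξ.1 j := fun j =>
    (measurable_ringTime j).comp measurable_subtype_coe
  have hind : IndepFun (fun ω : Fin (n + 1) → ClockSpace => ω k) (fun ω => ω k')
      (Measure.pi fun k => clockMeasure (r k)) :=
    (iIndepFun_pi (μ := fun k => clockMeasure (r k)) (X := fun _ ξ => ξ)
      fun _ => aemeasurable_id).indepFun hk
  have h := measure_eq_zero_of_indepFun ((hm j).comp (measurable_pi_apply k))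
    ((hm j').comp (measurable_pi_apply k')) (hind.comp (hm j) (hm j')) fun c => ?_
  · simp only [ae_iff, Ne, not_not]
    exact h
  · exact ((measurePreserving_eval (fun k => clockMeasure (r k)) k).measure_preimage
      (hm j (measurableSet_singleton c)).nullMeasurableSet).trans
      (clockMeasure_ringTime_eq (hr k) j c)

/-! ### Positive probability of coalescence -/

theorem rate_pos {n : ℕ} {α β : ℝ} {h : ℕ → ℝ} (hα : 0 < α) (hβ : 0 < β)
    (hh : ∀ k, 1 ≤ k → k < n → 0 < h k) (k : Fin (n + 1)) : 0 < rate n α β h k := by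
  unfold rate
  split_ifs with h0 h1
  · exact hα
  · exact hβ
  · exact hh k (by omega) (by omega)

theorem window_isOpen (n : ℕ) (t : ℝ) (k i : ℕ) : IsOpen (window n t k i) := by
  unfold window
  dsimp only
  split_ifs
  exacts [isOpen_Ioi, isOpen_Ioo, isOpen_Ioo]

theorem window_nonempty {n : ℕ} [NeZero n] {t : ℝ} (ht : 0 < t) (k i : ℕ) :
    (window n t k i).Nonempty := by
  have hn : (0 : ℝ) < n := by exact_mod_cast NeZero.pos n
  unfold window
  dsimp only
  split_ifs
  · exact nonempty_Ioi
  all_goals exact nonempty_Ioo.2 (lt_add_of_pos_right _ (by positivity))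

theorem window_subset_Ioi {n : ℕ} {t : ℝ} (ht : 0 < t) (k i : ℕ) : window n t k i ⊆ Ioi 0 := by
  unfold window
  dsimp only
  split_ifs
  · exact Ioi_subset_Ioi ht.le
  all_goals exact Ioo_subset_Ioi_self.trans (Ioi_subset_Ioi (by positivity))

theorem prob_Γ_zero_pos {n : ℕ} [NeZero n] {α β : ℝ} {h : ℕ → ℝ} (hα : 0 < α) (hβ : 0 < β)
    (hh : ∀ k, 1 ≤ k → k < n → 0 < h k) {t : ℝ} (ht : 0 < t) : 0 < prob n α β h (Γ n t 0) := by
  have hr := rate_pos hα hβ hh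
  have := fun k => isProbabilityMeasure_clockMeasure (hr k)
  let B : Fin (n + 1) → Set ClockSpace := fun k =>
    {ξ | ∀ i : ℕ, i ≤ n → ξ.1 i ∈ window n t k i}
  have hB : ∀ k, MeasurableSet (B k) := by
    intro k
    simp only [B, ofPred_forall]
    exact MeasurableSet.iInter fun i => MeasurableSet.iInter fun _ =>
      ((measurable_pi_apply _).comp measurable_subtype_coe) (window_isOpen n t k i).measurableSet
  have hsub : (Subtype.val ⁻¹' Set.pi univ B : Set (Sample n)) ⊆ Γ n t 0 := fun ω hω =>
    mem_Γ_zero_of_window ht fun k => hω k (mem_univ k)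
  refine lt_of_lt_of_le ?_ (measure_mono hsub)
  rw [prob, comap_subtype_val_preimage (ae_ringTime_ne hr) (MeasurableSet.univ_pi hB),
    Measure.pi_pi, CanonicallyOrderedAdd.prod_pos]
  exact fun k _ => clockMeasure_box_pos (hr k) n (window_isOpen n t k) (window_nonempty ht k)
    (window_subset_Ioi ht k)

theorem isProbabilityMeasure_prob {n : ℕ} {α β : ℝ} {h : ℕ → ℝ} (hα : 0 < α) (hβ : 0 < β)
    (hh : ∀ k, 1 ≤ k → k < n → 0 < h k) : IsProbabilityMeasure (prob n α β h) := by
  have hr := rate_pos hα hβ hh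
  have := fun k => isProbabilityMeasure_clockMeasure (hr k)
  refine ⟨?_⟩
  have h := comap_subtype_val_preimage (ae_ringTime_ne hr) MeasurableSet.univ
  rw [preimage_univ] at h
  exact h.trans measure_univ

end TASEP

theorem mainTheorem4 (n : ℕ) [NeZero n] (α β : ℝ) (h : ℕ → ℝ) (hα : 0 < α) (hβ : 0 < β)
    (hh : ∀ k, 1 ≤ k → k < n → 0 < h k) (t : ℝ) (ht : 0 < t) :
    MeasurableSet (TASEP.Γ n t 0) ∧
      ∃ δ : ℝ, 0 < δ ∧ δ ≤ (TASEP.prob n α β h).real (TASEP.Γ n t 0) := by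
  have := TASEP.isProbabilityMeasure_prob hα hβ hh
  -- The witness `δ` is the probability itself; its finiteness keeps it positive as a real number.
  exact ⟨TASEP.measurableSet_Γ_zero n t, _,
    ENNReal.toReal_pos (TASEP.prob_Γ_zero_pos hα hβ hh ht).ne' (measure_ne_top _ _), le_rfl⟩
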